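/- A deterministic one-tape Turing machine (DTM) is a tuple $\langle Q,\Sigma,\Gamma,\delta,q_0,F\rangle$ with a finite set of states $Q$, an initial state $q_0\in Q$, final states $F\subseteq Q$, a finite working alphabet $\Gamma$ containing a blank symbol $\flat$, an input alphabet $\Sigma\subseteq\Gamma\setminus\{\flat\}$, and a partial transition function $\delta:Q\times\Gamma\to Q\times(\Gamma\setminus\{\flat\})\times\{\text{left},\text{right}\}$; in each step it changes its state, overwrites the scanned cell and moves its head one cell to the left or right, and it halts when no transition applies. The DTM is end-marked if $\Gamma\setminus(\Sigma\cup\{\flat\})$ contains two distinct symbols $\rhd,\lhd$ (the endmarkers) such that $\delta(p,\rhd)=(q,\tau,m)$ implies $\tau=\rhd$, $m=\text{right}$, and $\delta(p,\lhd)=(q,\tau,m)$ implies $\tau=\lhd$, $m=\text{left}$. On input $w\in\Sigma^*$ it starts in state $q_0$ with the tape containing $\rhd w\lhd$, surrounded by blanks, and with the head on $\rhd$. It works in linear time if there are constants $K,C$ such that on every input $w\in\Sigma^*$ it halts after at most $K|w|+C$ steps. **Theorem.** It is undecidable whether an end-marked DTM works in linear time: there is no algorithm that, given a description (as a tuple of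 numbers and finite lists) of an end-marked DTM, always halts and correctly answers whether that machine works in linear time. -/

import Mathlib

/-!
Deterministic one-tape Turing machines given by finite descriptions, end-marked machines, linear
time, and decidability of a property of descriptions.
-/

namespace OneTape

open Turing

/-- The two head moves, numbered `left ↦ false`, `right ↦ true`. -/
def dirEquivBool : Dir ≃ Bool where
  toFun
    | Dir.left => false
    | Dir.right => true
  invFun
    | false => Dir.left
    | true => Dir.right
  left_inv d := by cases d <;> rfl
  right_inv b := by cases b <;> rfl

instance instPrimcodableDir : Primcodable Dir := Primcodable.ofEquiv Bool dirEquivBool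

/-- A description of a deterministic one-tape Turing machine `⟨Q, Σ, Γ, δ, q₀, F⟩`.
The states are `0, …, numStates - 1`, the working symbols are `0, …, numSymbols - 1`, and the
partial transition function is given by its finite table: an entry `((p, σ), (q, τ, d))` says
`δ(p, σ) = (q, τ, d)` (if a pair `(p, σ)` is listed more than once, the first entry counts).
Which descriptions are legal is said in `DTM.Valid`. -/
structure DTM where
  numStates : ℕ
  numSymbols : ℕ
  inputAlphabet : List ℕ
  table : List ((ℕ × ℕ) × (ℕ × ℕ × Dir))
  start : ℕ
  final : List ℕ

namespace DTM

/-- A description is a tuple of numbers and finite lists. -/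
def equivTuple :
    DTM ≃ ℕ × ℕ × List ℕ × List ((ℕ × ℕ) × (ℕ × ℕ × Dir)) × ℕ × List ℕ where
  toFun M := (M.numStates, M.numSymbols, M.inputAlphabet, M.table, M.start, M.final)
  invFun t := ⟨t.1, t.2.1, t.2.2.1, t.2.2.2.1, t.2.2.2.2.1, t.2.2.2.2.2⟩
  left_inv _ := rfl
  right_inv _ := rfl

/-- Descriptions are coded as the tuples that they are, by Mathlib's coding of pairs and lists. -/
instance instPrimcodable : Primcodable DTM := Primcodable.ofEquiv _ equivTuple

/-- The blank symbol (it is `default : ℕ`, the blank of Mathlib's tapes). -/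
def blank : ℕ := 0

/-- The left endmarker. -/
def lend : ℕ := 1

/-- The right endmarker. -/
def rend : ℕ := 2

/-- The partial transition function. -/
def δ (M : DTM) (p σ : ℕ) : Option (ℕ × ℕ × Dir) := M.table.lookup (p, σ)

/-- `M` describes a deterministic one-tape Turing machine: the initial and the final states are
states, the blank is a working symbol, the input symbols are working symbols other than the blank,
and `δ` is a partial function from `Q × Γ` to `Q × (Γ \ {blank}) × {left, right}`. -/
structure Valid (M : DTM) : Prop where
  start_lt : M.start < M.numStates
  final_lt : ∀ q ∈ M.final, q < M.numStates
  blank_lt : blank < M.numSymbols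
  input_lt : ∀ a ∈ M.inputAlphabet, a < M.numSymbols
  blank_notMem : blank ∉ M.inputAlphabet
  δ_spec : ∀ p σ q τ d, M.δ p σ = some (q, τ, d) →
    p < M.numStates ∧ σ < M.numSymbols ∧ q < M.numStates ∧ τ < M.numSymbols ∧ τ ≠ blank

/-- `M` describes an end-marked machine: the endmarkers are working symbols that are not input
symbols, they are never overwritten, and the head moves right from the left endmarker and left
from the right one. -/
structure EndMarked (M : DTM) : Prop extends M.Valid where
  lend_lt : lend < M.numSymbols
  rend_lt : rend < M.numSymbols
  lend_notMem : lend ∉ M.inputAlphabet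
  rend_notMem : rend ∉ M.inputAlphabet
  δ_lend : ∀ p q τ d, M.δ p lend = some (q, τ, d) → τ = lend ∧ d = Dir.right
  δ_rend : ∀ p q τ d, M.δ p rend = some (q, τ, d) → τ = rend ∧ d = Dir.left

/-- A configuration: the current state, and the contents of the bi-infinite tape together with the
position of the head. -/
structure Cfg where
  state : ℕ
  tape : Tape ℕ

/-- One step: change the state, overwrite the scanned cell, move the head by one cell. The result
is `none` if no transition applies, that is, if the configuration is halting. -/
def step (M : DTM) (c : Cfg) : Option Cfg :=
  (M.δ c.state c.tape.head).map fun r => ⟨r.1, (c.tape.write r.2.1).move r.2.2⟩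

/-- The initial configuration of an end-marked machine on the input `w`: the tape holds
`lend w rend`, surrounded by blanks, and the head scans `lend`. -/
def initEndMarked (M : DTM) (w : List ℕ) : Cfg :=
  ⟨M.start, Tape.mk₁ (lend :: (w ++ [rend]))⟩

/-- The computation from `c` reaches a halting configuration after at most `t` steps. -/
def HaltsWithin (M : DTM) (c : Cfg) (t : ℕ) : Prop :=
  ∃ k ≤ t, ∃ c' : Cfg, (fun o : Option Cfg => o.bind M.step)^[k] (some c) = some c' ∧
    M.step c' = none

/-- The end-marked machine `M` works in linear time: over each input word `w` its computation
halts within `O(|w|)` steps. -/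
def LinearTime (M : DTM) : Prop :=
  ∃ K C : ℕ, ∀ w : List ℕ, (∀ a ∈ w, a ∈ M.inputAlphabet) →
    M.HaltsWithin (M.initEndMarked w) (K * w.length + C)

end DTM

/-- It is decidable whether an instance `a` with `D a` has the property `P`: some algorithm halts
with the correct answer on every such instance (nothing is required of it on the other codes). -/
def DecidableOn {α : Type*} [Primcodable α] (D P : α → Prop) : Prop :=
  ∃ f : α →. Bool, Partrec f ∧ ∀ a, D a → ∃ b ∈ f a, (b = true ↔ P a)

end OneTape

/-! The halting problem reduces to linear time. The universal partial function `n ↦ (code n).eval 0`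
is computed by one fixed `TM0` machine `M` with finitely many letters and states, on an input word
that depends computably on `n` (`exists_tm0_of_partrec`). From that word `c` one compiles an
end-marked machine over the input letters `3` and `4`. It walks to the first `4`, writes `c` just to
the left of it, and simulates `M` there, reading the remaining input letters as blanks. The `4` lets
the input choose how much room the simulation has on either side. If the simulation hits an
endmarker, the machine erases the block of visited cells one cell per round trip, which takes time
quadratic in the length of the block, and halts.

If `M` halts after `s` steps, the visited block has at most `|c| + s` cells on every input, so all
the work apart from the walk is bounded by a constant (`linearTime_of_haltsIn`). If `M` does not
halt, take the input `3^m 4 3^m`. Either the simulation goes on forever, or it reaches an endmarker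
after visiting at least `m` cells, and then the erasing takes at least `m²` steps
(`not_linearTime_of_not_haltsIn`).

The invariant tying the tape to the simulated configuration is `Represents`. The cost of the erasing
is computed exactly in `exists_haltsIn_erase`. -/

namespace OneTape

open Turing

/-! ### A finite Turing machine for a partial recursive function. -/

/-- The binary digits of a natural number depend primitively recursively on it. -/
theorem primrec_bits : Primrec Nat.bits := by
  have hg : Primrec₂ (fun (_ : Unit) (l : List (List Bool)) =>
      if l.length = 0 then some ([] : List Bool)
      else (l[l.length.div2]?).map fun r => l.length.bodd :: r) := by
    have hl : Primrec fun p : Unit × List (List Bool) => p.2.length :=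
      Primrec.list_length.comp Primrec.snd
    refine Primrec.ite (Primrec.eq.comp hl (Primrec.const 0)) (Primrec.const _) ?_
    refine Primrec.option_map
      (Primrec.list_getElem?.comp Primrec.snd (Primrec.nat_div2.comp hl)) ?_
    exact Primrec.list_cons.comp (Primrec.nat_bodd.comp (hl.comp Primrec.fst)) Primrec.snd
  have := Primrec.nat_strong_rec (fun (_ : Unit) n => Nat.bits n) hg fun _ n => by
    rcases Nat.eq_zero_or_pos n with rfl | hn
    · simp
    · have hlt : n.div2 < n := Nat.binaryRec_decreasing hn.ne'
      -- The side condition excludes a leading digit `0`: for `n > 0` with `n.div2 = 0` the last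
      -- digit is `1`.
      have hb := Nat.bits_append_bit n.div2 n.bodd fun h => by
        have := Nat.bit_bodd_div2 n
        rw [h] at this
        cases hb : n.bodd
        · rw [hb] at this; simp at this; omega
        · rfl
      rw [Nat.bit_bodd_div2] at hb
      simp [hn.ne', hlt, hb]
  exact this.comp (Primrec.const ()) Primrec.id

/-- The letter that `PartrecToTM2` uses for a binary digit. -/
def bitLetter (b : Bool) : PartrecToTM2.Γ' :=
  cond b PartrecToTM2.Γ'.bit1 PartrecToTM2.Γ'.bit0

theorem trPosNum_eq_map_bits (p : PosNum) :
    PartrecToTM2.trPosNum p = (p : ℕ).bits.map bitLetter := by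
  induction p with
  | one => simp [PartrecToTM2.trPosNum, bitLetter]
  | bit1 p ih =>
    rw [PosNum.cast_bit1, ← two_mul, Nat.bit1_bits, PartrecToTM2.trPosNum, ih]; rfl
  | bit0 p ih =>
    rw [PosNum.cast_bit0, ← two_mul, Nat.bit0_bits _ (PosNum.cast_pos p).ne',
      PartrecToTM2.trPosNum, ih]; rfl

theorem trNat_eq_map_bits (n : ℕ) : PartrecToTM2.trNat n = n.bits.map bitLetter := by
  have h : ((n : Num) : ℕ) = n := Num.to_of_nat n
  rw [PartrecToTM2.trNat]
  cases hn : (n : Num) with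
  | zero =>
    rw [hn] at h
    have : n = 0 := h.symm
    subst this; rfl
  | pos p =>
    rw [hn] at h
    have : (p : ℕ) = n := h
    rw [← this]; exact trPosNum_eq_map_bits p

/-- Codes are replaced by their numbers, so that the instance of the halting problem can serve as
the numerical input of one fixed machine. -/
theorem halting_problem_nat :
    ¬ComputablePred fun n : ℕ => ((Denumerable.ofNat Nat.Partrec.Code n).eval 0).Dom := by
  intro h
  refine ComputablePred.halting_problem 0 (ComputablePred.computable_of_manyOneReducible ?_ h)
  exact ⟨Encodable.encode, Computable.encode, fun c => by simp⟩

/-- A partial recursive function is computed by a machine of the model `TM0` that has finitely many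
symbols and is supported on finitely many states, from an input that is computable letterwise. -/
theorem exists_tm0_of_partrec {φ : ℕ →. ℕ} (hφ : Partrec φ) :
    ∃ (Γ Λ : Type) (_ : Inhabited Γ) (_ : Inhabited Λ) (_ : Fintype Γ) (M : TM0.Machine Γ Λ)
      (S : Finset Λ) (input : ℕ → List Γ),
      TM0.Supports M (S : Set Λ) ∧ (∀ f : Γ → ℕ, Computable fun n => (input n).map f) ∧
      ∀ n, (StateTransition.eval (TM0.step M) (TM0.init (input n))).Dom ↔ (φ n).Dom := by
  obtain ⟨c, hc⟩ := ToPartrec.Code.exists_code (Nat.Partrec'.part_iff₁.2 hφ)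
  -- A machine starts in the default label, so the default is chosen to be the entry point of `c`.
  let iΛ : Inhabited PartrecToTM2.Λ' := ⟨PartrecToTM2.trNormal c PartrecToTM2.Cont'.halt⟩
  let iK : Fintype PartrecToTM2.K' :=
    ⟨{.main, .rev, .aux, .stack}, fun k => by cases k <;> simp⟩
  let M₁ := TM2to1.tr PartrecToTM2.tr
  let input (n : ℕ) := TM2to1.trInit (Γ := fun _ : PartrecToTM2.K' => PartrecToTM2.Γ')
    PartrecToTM2.K'.main (PartrecToTM2.trList [n])
  let S₂ := PartrecToTM2.codeSupp c PartrecToTM2.Cont'.halt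
  have hS₁ := TM2to1.tr_supports PartrecToTM2.tr
    (PartrecToTM2.tr_supports c PartrecToTM2.Cont'.halt)
  refine ⟨_, _, inferInstance, inferInstance, inferInstance, TM1to0.tr M₁,
    TM1to0.trStmts M₁ (TM2to1.trSupp PartrecToTM2.tr S₂), input, TM1to0.tr_supports M₁ hS₁,
    ?_, fun n => ?_⟩
  · intro f
    let g (a : PartrecToTM2.Γ') : TM2to1.Γ' PartrecToTM2.K' fun _ => PartrecToTM2.Γ' :=
      (false, Function.update (fun _ => none) PartrecToTM2.K'.main (some a))
    -- Only the first letter carries the mark `true` for the bottom of the stacks; the other letters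
    -- are the images of the binary digits of `n`.
    have hf : ∀ n, (input n).map f =
        f (true, (g PartrecToTM2.Γ'.cons).2) ::
          (n.bits.reverse.map fun b => f (g (bitLetter b))) := by
      intro n
      have hr : (PartrecToTM2.trList [n]).reverse =
          PartrecToTM2.Γ'.cons :: n.bits.reverse.map bitLetter := by
        simp [trNat_eq_map_bits]
      have hi : input n = (true, (g PartrecToTM2.Γ'.cons).2) ::
          (n.bits.reverse.map bitLetter).map g := by
        change TM2to1.trInit _ _ = _
        unfold TM2to1.trInit
        rw [hr]; rfl
      rw [hi]
      refine congrArg (List.cons _) ?_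
      exact (congrArg (List.map f) List.map_map).trans List.map_map
    simp only [hf]
    refine (Primrec.list_cons.comp (Primrec.const _) (Primrec.list_map
      (Primrec.list_reverse.comp primrec_bits) ?_)).to_comp
    exact (Primrec.dom_finite fun b : Bool => f (g (bitLetter b))).comp Primrec.snd
  · have h0 : (TM0.eval (TM1to0.tr M₁) (input n)).Dom ↔ (TM1.eval M₁ (input n)).Dom := by
      rw [TM1to0.tr_eval]
    have h1 : (TM1.eval M₁ (input n)).Dom ↔ (TM2.eval PartrecToTM2.tr PartrecToTM2.K'.main
        (PartrecToTM2.trList [n])).Dom := TM2to1.tr_eval_dom _ _ _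
    refine Iff.trans Iff.rfl (h0.trans (h1.trans ?_))
    have hi : (TM2.init PartrecToTM2.K'.main (PartrecToTM2.trList [n]) :
        TM2.Cfg (fun _ : PartrecToTM2.K' => PartrecToTM2.Γ') PartrecToTM2.Λ'
          (Option PartrecToTM2.Γ')) = PartrecToTM2.init c [n] := by
      simp only [TM2.init, PartrecToTM2.init]
      congr 1
      funext k; cases k <;> rfl
    change (StateTransition.eval _ (TM2.init _ _)).Dom ↔ _
    rw [hi, PartrecToTM2.tr_eval]
    have := hc (n ::ᵥ List.Vector.nil)
    change (c.eval [n]).Dom ↔ _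
    rw [show c.eval [n] = _ from this]
    rfl

/-! ### Exact halting times of deterministic systems. -/

section Runs

variable {α β : Type*}

/-- Iterating the partial function `f` from `a` stops after exactly `k` steps. -/
def HaltsIn (f : α → Option α) : ℕ → α → Prop
  | 0, a => f a = none
  | k + 1, a => ∃ b, f a = some b ∧ HaltsIn f k b

/-- Iterating `f` leads from `a` to `b` in `e` steps, as far as halting times are concerned. -/
def Run (f : α → Option α) (e : ℕ) (a b : α) : Prop :=
  ∀ j, HaltsIn f j a ↔ ∃ k, j = k + e ∧ HaltsIn f k b

variable {f : α → Option α} {g : β → Option β} {a b c : α} {e e' k : ℕ}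

theorem Run.refl (f : α → Option α) (a : α) : Run f 0 a a := fun j => by simp

theorem Run.trans (h : Run f e a b) (h' : Run f e' b c) : Run f (e + e') a c := fun j => by
  rw [h]
  constructor
  · rintro ⟨k, rfl, hk⟩
    obtain ⟨i, rfl, hi⟩ := (h' k).1 hk
    exact ⟨i, by omega, hi⟩
  · rintro ⟨k, rfl, hk⟩
    exact ⟨k + e', by omega, (h' _).2 ⟨k, rfl, hk⟩⟩

theorem Run.single (h : f a = some b) : Run f 1 a b := fun j => by
  cases j with
  | zero => simp [HaltsIn, h]
  | succ j => simp [HaltsIn, h]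

theorem Run.haltsIn (h : Run f e a b) (hk : HaltsIn f k b) : HaltsIn f (k + e) a :=
  (h _).2 ⟨k, rfl, hk⟩

theorem HaltsIn.unique {j : ℕ} (h : HaltsIn f j a) (h' : HaltsIn f k a) : j = k := by
  induction j generalizing a k with
  | zero =>
    cases k with
    | zero => rfl
    | succ k => obtain ⟨b, hb, -⟩ := h'; rw [HaltsIn, hb] at h; cases h
  | succ j ih =>
    obtain ⟨b, hb, h⟩ := h
    cases k with
    | zero => rw [HaltsIn, hb] at h'; cases h'
    | succ k =>
      obtain ⟨b', hb', h'⟩ := h'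
      cases hb.symm.trans hb'
      rw [ih h h']

theorem haltsIn_iff_iterate :
    HaltsIn f k a ↔ ∃ b, (fun o : Option α => o.bind f)^[k] (some a) = some b ∧ f b = none := by
  induction k generalizing a with
  | zero => simp [HaltsIn]
  | succ k ih =>
    simp only [HaltsIn, Function.iterate_succ_apply, Option.bind_some, ih]
    cases hf : f a with
    | some b => simp
    | none => simp [Function.iterate_fixed (f := fun o : Option α => o.bind f) (x := none) rfl k]

theorem eval_dom_iff_haltsIn : (StateTransition.eval f a).Dom ↔ ∃ k, HaltsIn f k a := by
  rw [Part.dom_iff_mem]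
  simp only [StateTransition.mem_eval]
  constructor
  · rintro ⟨b, hab, hb⟩
    induction hab using Relation.ReflTransGen.head_induction_on with
    | refl => exact ⟨0, hb⟩
    | head h _ ih =>
      obtain ⟨k, hk⟩ := ih
      exact ⟨k + 1, _, h, hk⟩
  · rintro ⟨k, hk⟩
    induction k generalizing a with
    | zero => exact ⟨a, Relation.ReflTransGen.refl, hk⟩
    | succ k ih =>
      obtain ⟨b, hb, hk⟩ := hk
      obtain ⟨c, hc, hc'⟩ := ih hk
      exact ⟨c, Relation.ReflTransGen.head hb hc, hc'⟩

/-- Step-by-step related systems have the same halting times. -/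
theorem haltsIn_congr (R : α → β → Prop)
    (hR : ∀ a b, R a b → (f a = none ∧ g b = none) ∨
      ∃ a' b', f a = some a' ∧ g b = some b' ∧ R a' b') {a : α} {b : β} (hab : R a b) :
    HaltsIn f k a ↔ HaltsIn g k b := by
  induction k generalizing a b with
  | zero => rcases hR a b hab with ⟨h, h'⟩ | ⟨a', b', h, h', -⟩ <;> simp [HaltsIn, h, h']
  | succ k ih =>
    rcases hR a b hab with ⟨h, h'⟩ | ⟨a', b', h, h', hab'⟩
    · simp [HaltsIn, h, h']
    · simp [HaltsIn, h, h', ih hab']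

end Runs

/-! ### Configurations with absolute cell positions. -/

/-- A head move as a change of position. -/
def dirShift : Dir → ℤ
  | Dir.left => -1
  | Dir.right => 1

theorem nth_move {Γ : Type*} [Inhabited Γ] (T : Tape Γ) (d : Dir) (i : ℤ) :
    (T.move d).nth i = T.nth (i + dirShift d) := by
  cases d
  · rw [Tape.move_left_nth]; rfl
  · rw [Tape.move_right_nth]; rfl

/-- A configuration of a one-tape machine with absolute positions of the cells. -/
structure AbsCfg where
  state : ℕ
  pos : ℤ
  cells : ℤ → ℕ

namespace DTM

/-- One step between configurations with absolute positions. -/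
def absStep (M : DTM) (c : AbsCfg) : Option AbsCfg :=
  (M.δ c.state (c.cells c.pos)).map fun r =>
    ⟨r.1, c.pos + dirShift r.2.2, Function.update c.cells c.pos r.2.1⟩

/-- A `Tape` is centred at its head, so each move renumbers all cells. With absolute positions only
the scanned cell changes in a step, which makes invariants about blocks of cells easy to state. -/
theorem haltsIn_step_iff_absStep (M : DTM) (c : Cfg) (k : ℕ) :
    HaltsIn M.step k c ↔ HaltsIn M.absStep k ⟨c.state, 0, c.tape.nth⟩ := by
  refine haltsIn_congr
    (fun c a => c.state = a.state ∧ ∀ i, c.tape.nth i = a.cells (a.pos + i)) ?_ (by simp)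
  rintro ⟨p, T⟩ ⟨p', h, t⟩ ⟨rfl, hT⟩
  have h0 : T.head = t h := by simpa using hT 0
  dsimp only at hT
  cases hδ : M.δ p (t h) with
  | none => exact Or.inl ⟨by simp [step, h0, hδ], by simp [absStep, hδ]⟩
  | some r =>
    refine Or.inr ⟨⟨r.1, (T.write r.2.1).move r.2.2⟩,
      ⟨r.1, h + dirShift r.2.2, Function.update t h r.2.1⟩,
      by simp [step, h0, hδ], by simp [absStep, hδ], rfl, fun i => ?_⟩
    dsimp only
    rw [nth_move, Tape.write_nth, hT, Function.update_apply]
    simp only [add_assoc, add_comm i, add_eq_left]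

theorem haltsWithin_iff (M : DTM) (c : Cfg) (t : ℕ) :
    M.HaltsWithin c t ↔ ∃ k ≤ t, HaltsIn M.absStep k ⟨c.state, 0, c.tape.nth⟩ := by
  refine exists_congr fun k => and_congr_right fun _ => ?_
  rw [← haltsIn_step_iff_absStep, haltsIn_iff_iterate]

theorem run_of_δ {M : DTM} {p q σ τ : ℕ} {d : Dir} {h : ℤ} {t : ℤ → ℕ} (hσ : t h = σ)
    (hδ : M.δ p σ = some (q, τ, d)) :
    Run M.absStep 1 ⟨p, h, t⟩ ⟨q, h + dirShift d, Function.update t h τ⟩ :=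
  Run.single (by simp [absStep, hσ, hδ])

theorem run_of_δ_self {M : DTM} {p q σ : ℕ} {d : Dir} {h : ℤ} {t : ℤ → ℕ} (hσ : t h = σ)
    (hδ : M.δ p σ = some (q, σ, d)) :
    Run M.absStep 1 ⟨p, h, t⟩ ⟨q, h + dirShift d, t⟩ := by
  have := run_of_δ hσ hδ
  rwa [← hσ, Function.update_eq_self] at this

theorem haltsIn_zero_of_δ {M : DTM} {p σ : ℕ} {h : ℤ} {t : ℤ → ℕ} (hσ : t h = σ)
    (hδ : M.δ p σ = none) : HaltsIn M.absStep 0 ⟨p, h, t⟩ := by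
  simp [HaltsIn, absStep, hσ, hδ]

/-- A state that steps in direction `d` over the symbols with the property `P` passes over a block
of such symbols. -/
theorem run_sweep {M : DTM} {p : ℕ} {d : Dir} {P : ℕ → Prop}
    (hδ : ∀ σ, P σ → M.δ p σ = some (p, σ, d)) {t : ℤ → ℕ} (n : ℕ) {h : ℤ}
    (hP : ∀ i < n, P (t (h + i * dirShift d))) :
    Run M.absStep n ⟨p, h, t⟩ ⟨p, h + n * dirShift d, t⟩ := by
  induction n with
  | zero => simpa using Run.refl _ _
  | succ n ih =>
    have h1 := (ih fun i hi => hP i (by omega)).trans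
      (run_of_δ_self rfl (hδ _ (hP n (by omega))))
    convert! h1 using 2
    push_cast; ring

end DTM

/-! ### Lookup in tables built from lists of keys. -/

theorem lookup_map_key {κ ν : Type*} [BEq κ] [LawfulBEq κ] (L : List κ) (v : κ → ν) (k : κ) :
    (L.map fun x => (x, v x)).lookup k = if L.contains k then some (v k) else none := by
  induction L with
  | nil => simp
  | cons a L ih =>
    rw [List.map_cons, List.lookup_cons, ih, List.contains_cons]
    by_cases h : k = a
    · subst h; simp
    · simp [beq_eq_false_iff_ne.2 h]

theorem lookup_filterMap_key {κ ν : Type*} [BEq κ] [LawfulBEq κ] (L : List κ)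
    (v : κ → Option ν) (k : κ) :
    (L.filterMap fun x => (v x).map fun y => (x, y)).lookup k =
      if L.contains k then v k else none := by
  induction L with
  | nil => simp
  | cons a L ih =>
    rw [List.filterMap_cons, List.contains_cons]
    by_cases h : k = a
    · subst h
      cases hv : v k with
      | none => simp only [Option.map_none, ih, hv]; simp
      | some y => simp
    · cases hv : v a with
      | none => simp [ih, h]
      | some y => simp [ih, List.lookup_cons, beq_eq_false_iff_ne.2 h]

theorem lookup_append {κ ν : Type*} [BEq κ] (L L' : List (κ × ν)) (k : κ) :
    (L ++ L').lookup k = (L.lookup k).or (L'.lookup k) := by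
  induction L with
  | nil => simp
  | cons a L ih =>
    rw [List.cons_append, List.lookup_cons, List.lookup_cons, ih]
    cases k == a.1 <;> rfl

/-! ### The compiled machine. -/

section Compile

variable {Γ Λ : Type} [Inhabited Γ] [Inhabited Λ] [Fintype Γ]

/-- The number of the cell content that stands for a visited cell with the letter `a`. -/
noncomputable def letterCode {Γ : Type} [Fintype Γ] (a : Γ) : ℕ := 6 + Fintype.equivFin Γ a

/-- The letter for which a cell content stands: unvisited cells stand for the blank. -/
noncomputable def letterOf (σ : ℕ) : Γ :=
  if h : 6 ≤ σ ∧ σ - 6 < Fintype.card Γ then (Fintype.equivFin Γ).symm ⟨σ - 6, h.2⟩ else default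

theorem letterOf_letterCode (a : Γ) : letterOf (letterCode a) = a := by
  have h : 6 ≤ letterCode a ∧ letterCode a - 6 < Fintype.card Γ := by simp [letterCode]
  rw [letterOf, dif_pos h, Equiv.symm_apply_eq]
  simp [letterCode]

theorem six_le_letterCode {Γ : Type} [Fintype Γ] (a : Γ) : 6 ≤ letterCode a := by
  simp [letterCode]

theorem letterCode_lt {Γ : Type} [Fintype Γ] (a : Γ) : letterCode a < 6 + Fintype.card Γ := by
  simp [letterCode]

theorem letterOf_of_lt {σ : ℕ} (h : σ < 6) : (letterOf σ : Γ) = default :=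
  dif_neg (by omega)

/-- The index of a state in the finite set `S`. -/
noncomputable def stateIdx {Λ : Type} (S : Finset Λ) (q : Λ) : ℕ :=
  open scoped Classical in if h : q ∈ S then S.equivFin ⟨q, h⟩ else 0

/-- The state with a given index. -/
noncomputable def stateOf (S : Finset Λ) (i : ℕ) : Λ :=
  if h : i < S.card then S.equivFin.symm ⟨i, h⟩ else default

theorem stateIdx_lt {Λ : Type} {S : Finset Λ} {q : Λ} (hq : q ∈ S) : stateIdx S q < S.card := by
  simp [stateIdx, hq]

theorem stateOf_stateIdx {S : Finset Λ} {q : Λ} (hq : q ∈ S) :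
    stateOf S (stateIdx S q) = q := by
  rw [stateOf, dif_pos (stateIdx_lt hq)]
  simp [stateIdx, hq]

theorem stateOf_mem {S : Finset Λ} {i : ℕ} (hi : i < S.card) : stateOf S i ∈ S := by
  rw [stateOf, dif_pos hi]
  exact Subtype.prop _

variable (M : TM0.Machine Γ Λ) (S : Finset Λ)

/-- The action of the simulating machine in the state that stands for the state `q` of `M`. -/
noncomputable def simulate (q : Λ) (σ : ℕ) : Option (ℕ × ℕ × Dir) :=
  if σ = 1 then some (1, 1, Dir.right)
  else if σ = 2 then some (1, 2, Dir.left)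
  else (M q (letterOf σ)).map fun r =>
    match r.2 with
    | TM0.Stmt.move d => (5 + 2 * stateIdx S r.1, letterCode (letterOf σ : Γ), d)
    | TM0.Stmt.write a => (6 + 2 * stateIdx S r.1, letterCode a, Dir.right)

/-- The part of the transition function that does not depend on the word to be prepared.
State `0` walks to the right to the first symbol `4`. State `4` enters the simulation after the
word has been written. The states `5 + 2 * i` stand for the states of `M`, and `6 + 2 * i` makes
the return move after a written letter. The states `1`, `2`, `3` erase a block of visited cells,
one cell from its right end in each round trip over the block. -/
noncomputable def coreδ (p σ : ℕ) : Option (ℕ × ℕ × Dir) :=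
  match p with
  | 0 => if σ = 1 ∨ σ = 3 then some (0, σ, Dir.right) else none
  | 1 => if 6 ≤ σ then some (1, σ, Dir.right)
      else if 2 ≤ σ then some (2, σ, Dir.left) else none
  | 2 => if 6 ≤ σ then some (3, 5, Dir.left) else none
  | 3 => if 6 ≤ σ then some (3, σ, Dir.left)
      else if σ = 1 ∨ σ = 3 ∨ σ = 4 then some (1, σ, Dir.right) else none
  | 4 => if σ = 1 ∨ σ = 3 ∨ σ = 4 then some (5 + 2 * stateIdx S default, σ, Dir.right) else none
  | n + 5 =>
    if n % 2 = 0 then simulate M S (stateOf S (n / 2)) σ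
    else if 2 ≤ σ then some (n + 4, σ, Dir.left) else none

/-- The keys of `coreTable`. -/
def coreKeys (Q G : ℕ) : List (ℕ × ℕ) := List.range (5 + 2 * Q) ×ˢ List.range' 1 (5 + G)

/-- The table of `coreδ`. -/
noncomputable def coreTable : List ((ℕ × ℕ) × (ℕ × ℕ × Dir)) :=
  (coreKeys S.card (Fintype.card Γ)).filterMap fun k => (coreδ M S k.1 k.2).map fun r => (k, r)

/-- The state in which `i` symbols are still to be written, for `Q` states of `M`. -/
def prefixState (Q i : ℕ) : ℕ := if i = 0 then 4 else 4 + 2 * Q + i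

/-- The keys of `prefixTable`. -/
def prefixKeys (Q : ℕ) (c : List ℕ) : List (ℕ × ℕ) :=
  (0, 4) :: ((List.range c.length).map (fun i => (5 + 2 * Q + i, 3)) ++
    (List.range c.length).map fun i => (5 + 2 * Q + i, 4))

/-- The values of `prefixTable`. -/
def prefixVal (Q : ℕ) (c : List ℕ) (k : ℕ × ℕ) : ℕ × ℕ × Dir :=
  if k.1 = 0 then (prefixState Q c.length, 4, Dir.left)
  else (prefixState Q (k.1 - (5 + 2 * Q)), c.getD (k.1 - (5 + 2 * Q)) 0, Dir.left)

/-- The transitions that write the word `c` from right to left. -/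
def prefixTable (Q : ℕ) (c : List ℕ) : List ((ℕ × ℕ) × (ℕ × ℕ × Dir)) :=
  (prefixKeys Q c).map fun k => (k, prefixVal Q c k)

/-- The machine that walks to the first symbol `4`, writes the word `c` to the left of it,
simulates `M` on it, and wastes time when it hits an endmarker. -/
noncomputable def compile (c : List ℕ) : DTM where
  numStates := 5 + 2 * S.card + c.length
  numSymbols := 6 + Fintype.card Γ
  inputAlphabet := [3, 4]
  table := prefixTable S.card c ++ coreTable M S
  start := 0
  final := []

theorem primrec_prefixTable (Q : ℕ) : Primrec (prefixTable Q) := by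
  have hlen : Primrec fun c : List ℕ => List.range c.length :=
    Primrec.list_range.comp Primrec.list_length
  have hkey : ∀ s : ℕ, Primrec fun c : List ℕ =>
      (List.range c.length).map fun i => (5 + 2 * Q + i, s) := fun s =>
    Primrec.list_map hlen
      ((Primrec.nat_add.comp (Primrec.const _) Primrec.snd).pair (Primrec.const s))
  have hkeys : Primrec (prefixKeys Q) :=
    Primrec.list_cons.comp (Primrec.const _) (Primrec.list_append.comp (hkey 3) (hkey 4))
  have hstate : Primrec (prefixState Q) :=
    Primrec.ite (Primrec.eq.comp Primrec.id (Primrec.const 0)) (Primrec.const 4)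
      (Primrec.nat_add.comp (Primrec.const _) Primrec.id)
  have hidx : Primrec fun p : List ℕ × (ℕ × ℕ) => p.2.1 - (5 + 2 * Q) :=
    Primrec.nat_sub.comp (Primrec.fst.comp Primrec.snd) (Primrec.const _)
  have hval : Primrec₂ (prefixVal Q) := by
    refine Primrec.ite (Primrec.eq.comp (Primrec.fst.comp Primrec.snd) (Primrec.const 0)) ?_ ?_
    · exact (hstate.comp (Primrec.list_length.comp Primrec.fst)).pair
        ((Primrec.const 4).pair (Primrec.const Dir.left))
    · exact (hstate.comp hidx).pair
        (((Primrec.list_getD 0).comp Primrec.fst hidx).pair (Primrec.const Dir.left))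
  exact Primrec.list_map hkeys (Primrec.snd.pair hval)

/-- Since `M` and `S` are fixed, `coreTable` is a constant, however noncomputably it was obtained.
Only `prefixTable` and the number of states vary with the word. -/
theorem primrec_compile : Primrec (compile M S) := by
  have h : Primrec fun c => DTM.equivTuple (compile M S c) :=
    (Primrec.nat_add.comp (Primrec.const _) Primrec.list_length).pair <|
      (Primrec.const _).pair <| (Primrec.const _).pair <|
      (Primrec.list_append.comp (primrec_prefixTable _) (Primrec.const _)).pair <|
      (Primrec.const _).pair (Primrec.const _)
  exact (Primrec.of_equiv_iff DTM.equivTuple).1 h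

variable {M S} {c : List ℕ}

theorem compile_δ (p σ : ℕ) :
    (compile M S c).δ p σ =
      if (p, σ) ∈ prefixKeys S.card c then some (prefixVal S.card c (p, σ))
      else if p < 5 + 2 * S.card ∧ 1 ≤ σ ∧ σ < 6 + Fintype.card Γ then coreδ M S p σ
      else none := by
  have hc : (coreKeys S.card (Fintype.card Γ)).contains (p, σ) ↔
      p < 5 + 2 * S.card ∧ 1 ≤ σ ∧ σ < 6 + Fintype.card Γ := by
    simp [coreKeys, List.mem_range'_1]; omega
  rw [DTM.δ, compile, lookup_append, prefixTable, lookup_map_key, coreTable,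
    lookup_filterMap_key (κ := ℕ × ℕ) (ν := ℕ × ℕ × Dir) _ (fun k => coreδ M S k.1 k.2)]
  simp only [hc, List.contains_iff_mem]
  split_ifs <;> rfl

theorem mem_prefixKeys {Q p σ : ℕ} : (p, σ) ∈ prefixKeys Q c ↔
    p = 0 ∧ σ = 4 ∨ (5 + 2 * Q ≤ p ∧ p < 5 + 2 * Q + c.length) ∧ (σ = 3 ∨ σ = 4) := by
  simp only [prefixKeys, List.mem_cons, Prod.mk.injEq, List.mem_append, List.mem_map,
    List.mem_range]
  constructor
  · rintro (h | ⟨i, hi, rfl, rfl⟩ | ⟨i, hi, rfl, rfl⟩)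
    · exact Or.inl h
    · exact Or.inr ⟨by omega, by simp⟩
    · exact Or.inr ⟨by omega, by simp⟩
  · rintro (h | ⟨h, h' | h'⟩)
    · exact Or.inl h
    · exact Or.inr (Or.inl ⟨p - (5 + 2 * Q), by omega, by omega, h'.symm⟩)
    · exact Or.inr (Or.inr ⟨p - (5 + 2 * Q), by omega, by omega, h'.symm⟩)

theorem compile_δ_core {p σ : ℕ} (hp : p < 5 + 2 * S.card) (h1 : 1 ≤ σ)
    (hσ : σ < 6 + Fintype.card Γ) (h : p ≠ 0 ∨ σ ≠ 4) :
    (compile M S c).δ p σ = coreδ M S p σ := by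
  rw [compile_δ, if_neg, if_pos ⟨hp, h1, hσ⟩]
  rw [mem_prefixKeys]; omega

theorem compile_δ_zero_four :
    (compile M S c).δ 0 4 = some (prefixState S.card c.length, 4, Dir.left) := by
  rw [compile_δ, if_pos (mem_prefixKeys.2 (by simp))]; simp [prefixVal]

theorem compile_δ_prefix {i σ : ℕ} (hi : i < c.length) (hσ : σ = 3 ∨ σ = 4) :
    (compile M S c).δ (prefixState S.card (i + 1)) σ =
      some (prefixState S.card i, c.getD i 0, Dir.left) := by
  have hs : prefixState S.card (i + 1) = 5 + 2 * S.card + i := by simp [prefixState]; omega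
  rw [hs, compile_δ, if_pos (mem_prefixKeys.2 (Or.inr ⟨by omega, hσ⟩)), prefixVal, if_neg,
    Nat.add_sub_cancel_left]
  omega

/-- If the left endmarker is met while letters are still to be written, the word does not fit and
the machine halts at once. -/
theorem compile_δ_prefix_lend {i : ℕ} :
    (compile M S c).δ (prefixState S.card (i + 1)) 1 = none := by
  have hs : prefixState S.card (i + 1) = 5 + 2 * S.card + i := by simp [prefixState]; omega
  rw [hs, compile_δ, if_neg, if_neg]
  · omega
  · rw [mem_prefixKeys]; omega

theorem simulate_spec (hS : TM0.Supports M (S : Set Λ)) {p : Λ} (hp : p ∈ S)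
    {σ q τ : ℕ} {d : Dir} (h : simulate M S p σ = some (q, τ, d)) :
    q < 5 + 2 * S.card ∧ τ < 6 + Fintype.card Γ ∧ τ ≠ 0 ∧
      (σ = 1 → τ = 1 ∧ d = Dir.right) ∧ (σ = 2 → τ = 2 ∧ d = Dir.left) := by
  rw [simulate] at h
  split_ifs at h with h1 h2
  · simp only [Option.some.injEq, Prod.mk.injEq] at h
    obtain ⟨rfl, rfl, rfl⟩ := h
    exact ⟨by omega, by omega, by omega, by simp, by omega⟩
  · simp only [Option.some.injEq, Prod.mk.injEq] at h
    obtain ⟨rfl, rfl, rfl⟩ := h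
    exact ⟨by omega, by omega, by omega, by omega, by simp⟩
  · rw [Option.map_eq_some_iff] at h
    obtain ⟨⟨q', s⟩, hM, h⟩ := h
    have hq := stateIdx_lt (Finset.mem_coe.1 (hS.2 hM (Finset.mem_coe.2 hp)))
    cases s with
    | move d' =>
      simp only [Prod.mk.injEq] at h
      obtain ⟨rfl, rfl, rfl⟩ := h
      have h6 := six_le_letterCode (letterOf σ : Γ)
      exact ⟨by omega, letterCode_lt _, by omega, by omega, by omega⟩
    | write a =>
      simp only [Prod.mk.injEq] at h
      obtain ⟨rfl, rfl, rfl⟩ := h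
      have h6 := six_le_letterCode a
      exact ⟨by omega, letterCode_lt _, by omega, by omega, by omega⟩

/-- The return states `6 + 2 * i` are undefined on the left endmarker, which they would have to
leave to the left. All other transitions on endmarkers bounce the head back inside. The support
condition on `S` keeps the state numbers in range. -/
theorem coreδ_spec (hS : TM0.Supports M (S : Set Λ)) {p σ q τ : ℕ} {d : Dir}
    (hp : p < 5 + 2 * S.card) (h1 : 1 ≤ σ) (hσ : σ < 6 + Fintype.card Γ)
    (h : coreδ M S p σ = some (q, τ, d)) :
    q < 5 + 2 * S.card ∧ τ < 6 + Fintype.card Γ ∧ τ ≠ 0 ∧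
      (σ = 1 → τ = 1 ∧ d = Dir.right) ∧ (σ = 2 → τ = 2 ∧ d = Dir.left) := by
  have h0 := stateIdx_lt (Finset.mem_coe.1 hS.1)
  unfold coreδ at h
  split at h
  case h_6 n =>
    split_ifs at h
    · exact simulate_spec hS (stateOf_mem (by omega)) h
    · simp only [Option.some.injEq, Prod.mk.injEq] at h
      obtain ⟨rfl, rfl, rfl⟩ := h
      exact ⟨by omega, by omega, by omega, by omega, by simp⟩
  all_goals
    split_ifs at h <;>
    · simp only [Option.some.injEq, Prod.mk.injEq] at h
      obtain ⟨rfl, rfl, rfl⟩ := h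
      refine ⟨by omega, by omega, by omega, ?_, ?_⟩ <;> intro h' <;> first | omega | simp [h']

theorem compile_endMarked (hS : TM0.Supports M (S : Set Λ))
    (hc : ∀ σ ∈ c, 6 ≤ σ ∧ σ < 6 + Fintype.card Γ) : (compile M S c).EndMarked := by
  have key : ∀ p σ q τ d, (compile M S c).δ p σ = some (q, τ, d) →
      p < 5 + 2 * S.card + c.length ∧ σ < 6 + Fintype.card Γ ∧
      q < 5 + 2 * S.card + c.length ∧ τ < 6 + Fintype.card Γ ∧ τ ≠ 0 ∧
      (σ = 1 → τ = 1 ∧ d = Dir.right) ∧ (σ = 2 → τ = 2 ∧ d = Dir.left) := by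
    intro p σ q τ d h
    rw [compile_δ] at h
    have hps : ∀ i ≤ c.length, prefixState S.card i < 5 + 2 * S.card + c.length := by
      intro i hi; rw [prefixState]; split_ifs <;> omega
    split_ifs at h with h1 h2
    · rw [mem_prefixKeys] at h1
      rcases h1 with ⟨rfl, rfl⟩ | ⟨h1, h2⟩
      · simp only [prefixVal, if_true, Option.some.injEq, Prod.mk.injEq] at h
        obtain ⟨rfl, rfl, rfl⟩ := h
        exact ⟨by omega, by omega, hps _ le_rfl, by omega, by omega, by omega, by omega⟩
      · rw [prefixVal, if_neg (by dsimp only; omega)] at h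
        simp only [Option.some.injEq, Prod.mk.injEq] at h
        obtain ⟨rfl, rfl, rfl⟩ := h
        have hlt : p - (5 + 2 * S.card) < c.length := by omega
        have := hc _ (List.getElem_mem hlt)
        rw [List.getD_eq_getElem _ _ hlt]
        exact ⟨by omega, by omega, hps _ hlt.le, this.2, by omega, by omega, by omega⟩
    · have := coreδ_spec hS h2.1 h2.2.1 h2.2.2 h
      exact ⟨by omega, h2.2.2, by omega, this.2⟩
  refine
    { start_lt := ?_, final_lt := ?_, blank_lt := ?_, input_lt := ?_, blank_notMem := ?_,
      δ_spec := ?_, lend_lt := ?_, rend_lt := ?_, lend_notMem := ?_, rend_notMem := ?_,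
      δ_lend := ?_, δ_rend := ?_ }
  · simp only [compile]; omega
  · simp [compile]
  · simp only [compile, DTM.blank]; omega
  · intro a ha
    simp only [compile, List.mem_cons, List.not_mem_nil, or_false] at ha ⊢
    omega
  · simp [compile, DTM.blank]
  · intro p σ q τ d h
    obtain ⟨h1, h2, h3, h4, h5, -⟩ := key _ _ _ _ _ h
    exact ⟨h1, h2, h3, h4, h5⟩
  · simp only [compile, DTM.lend]; omega
  · simp only [compile, DTM.rend]; omega
  · simp [compile, DTM.lend]
  · simp [compile, DTM.rend]
  · intro p q τ d h
    exact (key _ _ _ _ _ h).2.2.2.2.2.1 rfl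
  · intro p q τ d h
    exact (key _ _ _ _ _ h).2.2.2.2.2.2 rfl

end Compile

/-! ### The simulation invariant and the cost of the simulation. -/

section Simulation

variable {Γ Λ : Type} [Inhabited Γ] [Fintype Γ] {S : Finset Λ}

/-- The cells `t` with the head at `h` represent the configuration `a` of the simulated machine,
where the cells `1, …, n` lie between the endmarkers, and `u, …, u + L - 1` have been visited. -/
structure Represents (S : Finset Λ) (n u : ℤ) (L : ℕ) (a : TM0.Cfg Γ Λ) (h : ℤ) (t : ℤ → ℕ) :
    Prop where
  mem : a.q ∈ S
  one_le : 1 ≤ u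
  le : u ≤ n
  end_le : u + L ≤ n + 1
  le_pos : u - 1 ≤ h
  pos_le : h ≤ u + L
  lend : t 0 = 1
  rend : t (n + 1) = 2
  visited : ∀ i, u ≤ i → i < u + L → 6 ≤ t i ∧ t i < 6 + Fintype.card Γ
  fresh : ∀ i, 1 ≤ i → i ≤ n → i < u ∨ u + L ≤ i → t i = 3 ∨ t i = 4
  letter : ∀ i, 1 ≤ i → i ≤ n → letterOf (t i) = a.Tape.nth (i - h)

theorem Represents.move {n u : ℤ} {L : ℕ} {q : Λ} {T : Tape Γ} {h : ℤ} {t : ℤ → ℕ}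
    (hR : Represents S n u L ⟨q, T⟩ h t) (hu : u ≤ h) (hL : h < u + L) (d : Dir) :
    Represents S n u L ⟨q, T.move d⟩ (h + dirShift d) t :=
  { hR with
    mem := hR.mem
    le_pos := by cases d <;> simp only [dirShift] <;> omega
    pos_le := by cases d <;> simp only [dirShift] <;> omega
    letter := fun i hi hi' => by
      rw [hR.letter i hi hi', nth_move]
      congr 1; ring }

/-- The head is in the visited block or adjacent to it, so adding the scanned cell keeps the block
an interval and lengthens it by at most one. -/
theorem Represents.write {n u : ℤ} {L : ℕ} {q q' : Λ} {T : Tape Γ} {h : ℤ} {t : ℤ → ℕ}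
    (hR : Represents S n u L ⟨q, T⟩ h t) (h1 : 1 ≤ h) (hn : h ≤ n) (hq' : q' ∈ S) (a : Γ) :
    ∃ (u' : ℤ) (L' : ℕ), u' ≤ u ∧ u + L ≤ u' + L' ∧ L' ≤ L + 1 ∧ u' ≤ h ∧ h < u' + L' ∧
      Represents S n u' L' ⟨q', T.write a⟩ h (Function.update t h (letterCode a)) := by
  have hlp := hR.le_pos
  have hpl := hR.pos_le
  have hle := hR.le
  have hone := hR.one_le
  have hend := hR.end_le
  obtain ⟨u', L', h₁, h₂, h₃, h₄, h₅, h₆, h₇, h₈⟩ : ∃ (u' : ℤ) (L' : ℕ), u' ≤ u ∧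
      u + L ≤ u' + L' ∧ L' ≤ L + 1 ∧ u' ≤ h ∧ h < u' + L' ∧ 1 ≤ u' ∧ u' + L' ≤ n + 1 ∧
      ∀ i, u' ≤ i → i < u' + L' → i = h ∨ u ≤ i ∧ i < u + L := by
    rcases lt_trichotomy h u with hlt | rfl | hlt
    · exact ⟨u - 1, L + 1, by omega, by omega, by omega, by omega, by omega, by omega, by omega,
        by omega⟩
    -- The block may still be empty when the head is at its left end; then it becomes the single
    -- cell `h`.
    · exact ⟨h, max L 1, by omega, by omega, by omega, by omega, by omega, by omega, by omega,
        by omega⟩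
    · rcases lt_or_eq_of_le hpl with hlt' | heq
      · exact ⟨u, L, by omega, by omega, by omega, by omega, by omega, by omega, by omega,
          by omega⟩
      · exact ⟨u, L + 1, by omega, by omega, by omega, by omega, by omega, by omega, by omega,
          by omega⟩
  refine ⟨u', L', h₁, h₂, h₃, h₄, h₅,
    { mem := hq', one_le := h₆, le := by omega, end_le := h₇, le_pos := by omega,
      pos_le := by omega, lend := ?_, rend := ?_, visited := ?_, fresh := ?_, letter := ?_ }⟩
  · rw [Function.update_of_ne (by omega), hR.lend]
  · rw [Function.update_of_ne (by omega), hR.rend]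
  · intro i hi hi'
    by_cases hih : i = h
    · subst hih
      rw [Function.update_self]
      exact ⟨six_le_letterCode a, letterCode_lt a⟩
    · rw [Function.update_of_ne hih]
      have := h₈ i hi hi'
      exact hR.visited i (by omega) (by omega)
  · intro i hi hi' hout
    rw [Function.update_of_ne (by omega)]
    exact hR.fresh i hi hi' (by omega)
  · intro i hi hi'
    by_cases hih : i = h
    · subst hih
      rw [Function.update_self, letterOf_letterCode, sub_self, Tape.write_nth, if_pos rfl]
    · rw [Function.update_of_ne hih, hR.letter i hi hi', Tape.write_nth, if_neg (by omega)]

theorem Represents.symbol_bounds {n u : ℤ} {L : ℕ} {a : TM0.Cfg Γ Λ} {h : ℤ} {t : ℤ → ℕ}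
    (hR : Represents S n u L a h t) {i : ℤ} (h1 : 1 ≤ i) (hn : i ≤ n) :
    3 ≤ t i ∧ t i < 6 + Fintype.card Γ := by
  by_cases hi : u ≤ i ∧ i < u + L
  · have := hR.visited i hi.1 hi.2; omega
  · have := hR.fresh i h1 hn (by omega); omega

variable [Inhabited Λ] {M : TM0.Machine Γ Λ} {c : List ℕ}

/-- In a block of `L` visited cells, the erasing states need a number of steps that is quadratic
in `L`. -/
theorem exists_haltsIn_erase (L : ℕ) {u p : ℤ} {t : ℤ → ℕ} (hu : u ≤ p) (hp : p ≤ u + L)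
    (hV : ∀ i, u ≤ i → i < u + L → 6 ≤ t i ∧ t i < 6 + Fintype.card Γ)
    (hl : t (u - 1) = 1 ∨ t (u - 1) = 3 ∨ t (u - 1) = 4) (hr : 2 ≤ t (u + L) ∧ t (u + L) < 6) :
    ∃ j : ℕ, HaltsIn (compile M S c).absStep j ⟨1, p, t⟩ ∧
      (j : ℤ) = L ^ 2 + 3 * L + 1 - (p - u) := by
  have h1 : ∀ σ, 6 ≤ σ ∧ σ < 6 + Fintype.card Γ →
      (compile M S c).δ 1 σ = some (1, σ, Dir.right) := fun σ hσ => by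
    rw [compile_δ_core (by omega) (by omega) hσ.2 (by omega)]
    simp [coreδ, hσ.1]
  have h3 : ∀ σ, 6 ≤ σ ∧ σ < 6 + Fintype.card Γ →
      (compile M S c).δ 3 σ = some (3, σ, Dir.left) := fun σ hσ => by
    rw [compile_δ_core (by omega) (by omega) hσ.2 (by omega)]
    simp [coreδ, hσ.1]
  induction L generalizing u p t with
  | zero =>
    obtain rfl : p = u := by push_cast at hp; omega
    have ha : (compile M S c).δ 1 (t p) = some (2, t p, Dir.left) := by
      simp only [Nat.cast_zero, add_zero] at hr
      rw [compile_δ_core (by omega) (by omega) (by omega) (by omega)]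
      simp [coreδ, hr.1, not_le.2 hr.2]
    -- With an empty block, state `2` finds no visited cell to erase, and the machine halts after
    -- one step.
    have hb : (compile M S c).δ 2 (t (p - 1)) = none := by
      rw [compile_δ_core (by omega) (by omega) (by omega) (by omega)]
      have : ¬6 ≤ t (p - 1) := by omega
      simp [coreδ, this]
    exact ⟨_, (DTM.run_of_δ_self rfl ha).haltsIn (DTM.haltsIn_zero_of_δ rfl hb), by simp⟩
  | succ L ih =>
    push_cast at hp hV hr ⊢
    obtain ⟨d, hd⟩ := Int.le.dest hp
    have r1 : Run (compile M S c).absStep d ⟨1, p, t⟩ ⟨1, u + (L + 1), t⟩ := by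
      have := DTM.run_sweep (M := compile M S c) (p := 1) h1 (t := t) (h := p) d fun i hi =>
        hV _ (by simp only [dirShift]; omega) (by simp only [dirShift]; omega)
      convert! this using 2
      simp only [dirShift]; omega
    have r2 : Run (compile M S c).absStep 1 ⟨1, u + (L + 1), t⟩ ⟨2, u + L, t⟩ := by
      have ha : (compile M S c).δ 1 (t (u + (L + 1))) =
          some (2, t (u + (L + 1)), Dir.left) := by
        rw [compile_δ_core (by omega) (by omega) (by omega) (by omega)]
        simp [coreδ, hr.1, not_le.2 hr.2]
      convert! DTM.run_of_δ_self rfl ha using 2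
      simp only [dirShift]; omega
    have hVL := hV (u + L) (by omega) (by omega)
    have r3 : Run (compile M S c).absStep 1 ⟨2, u + L, t⟩
        ⟨3, u + L - 1, Function.update t (u + L) 5⟩ := by
      refine DTM.run_of_δ (d := Dir.left) rfl ?_
      rw [compile_δ_core (by omega) (by omega) hVL.2 (by omega)]
      simp [coreδ, hVL.1]
    set t' := Function.update t (u + L) 5 with ht'
    have ht'_ne : ∀ i, i ≠ u + L → t' i = t i := fun i hi => by
      rw [ht', Function.update_of_ne hi]
    have r4 : Run (compile M S c).absStep L ⟨3, u + L - 1, t'⟩ ⟨3, u - 1, t'⟩ := by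
      have := DTM.run_sweep (M := compile M S c) (p := 3) h3 (t := t') (h := u + L - 1) L
        fun i hi => by
          simp only [dirShift]
          rw [ht'_ne _ (by omega)]
          exact hV _ (by omega) (by omega)
      convert! this using 2
      simp only [dirShift]; omega
    have hl' : t' (u - 1) = t (u - 1) := ht'_ne _ (by omega)
    have r5 : Run (compile M S c).absStep 1 ⟨3, u - 1, t'⟩ ⟨1, u, t'⟩ := by
      have ha : (compile M S c).δ 3 (t' (u - 1)) = some (1, t' (u - 1), Dir.right) := by
        rw [hl', compile_δ_core (by omega) (by omega) (by omega) (by omega)]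
        have : ¬6 ≤ t (u - 1) := by omega
        simp [coreδ, this, hl]
      convert! DTM.run_of_δ_self rfl ha using 2
      simp only [dirShift]; omega
    -- The `5` just written is the right border of the shortened block, and the next round starts at
    -- its left end.
    obtain ⟨j, hj, hjL⟩ := ih (u := u) (p := u) (t := t') le_rfl (by omega)
      (fun i hi hi' => by rw [ht'_ne _ (by omega)]; exact hV i hi (by omega))
      (by rw [hl']; exact hl) (by simp [ht'])
    refine ⟨_, ((((r1.trans r2).trans r3).trans r4).trans r5).haltsIn hj, ?_⟩
    push_cast
    rw [hjL]
    have : (d : ℤ) = u + (L + 1) - p := by omega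
    rw [this]; ring

/-- The absolute configuration in which the simulating machine is in the state for `q`. -/
noncomputable def simCfg (S : Finset Λ) (q : Λ) (h : ℤ) (t : ℤ → ℕ) : AbsCfg :=
  ⟨5 + 2 * stateIdx S q, h, t⟩

/-- One step of the simulated machine takes one or two steps of the simulating machine, unless the
latter is on an endmarker. -/
theorem Represents.step (hS : TM0.Supports M (S : Set Λ)) {n u : ℤ} {L : ℕ} {a : TM0.Cfg Γ Λ}
    {h : ℤ} {t : ℤ → ℕ} (hR : Represents S n u L a h t) (h1 : 1 ≤ h) (hn : h ≤ n) :
    (TM0.step M a = none ∧ HaltsIn (compile M S c).absStep 0 (simCfg S a.q h t)) ∨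
    ∃ (a' : TM0.Cfg Γ Λ) (u' : ℤ) (L' : ℕ) (h' : ℤ) (t' : ℤ → ℕ) (e : ℕ),
      TM0.step M a = some a' ∧ u' ≤ u ∧ u + L ≤ u' + L' ∧ L' ≤ L + 1 ∧ 1 ≤ e ∧ e ≤ 2 ∧
      Represents S n u' L' a' h' t' ∧
      Run (compile M S c).absStep e (simCfg S a.q h t) (simCfg S a'.q h' t') := by
  obtain ⟨q, T⟩ := a
  have hT : letterOf (t h) = T.head := by simpa using hR.letter h h1 hn
  have hσ := hR.symbol_bounds h1 hn
  have hq : q ∈ S := hR.mem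
  have hδ : (compile M S c).δ (5 + 2 * stateIdx S q) (t h) = simulate M S q (t h) := by
    have := stateIdx_lt hq
    rw [compile_δ_core (by omega) (by omega) (by omega) (by omega),
      show 5 + 2 * stateIdx S q = 2 * stateIdx S q + 5 by omega]
    simp [coreδ, stateOf_stateIdx hq]
  rw [simulate, if_neg (by omega), if_neg (by omega), hT] at hδ
  rcases hM : M q T.head with _ | ⟨q', s⟩
  · rw [hM] at hδ
    exact Or.inl ⟨by simp [TM0.step, hM], DTM.haltsIn_zero_of_δ rfl hδ⟩
  have hq' : q' ∈ S := Finset.mem_coe.1 (hS.2 hM (Finset.mem_coe.2 hq))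
  rw [hM, Option.map_some] at hδ
  right
  cases s with
  | move d =>
    -- A pure move also marks its cell as visited, by writing the code of the letter that the cell
    -- already stands for.
    obtain ⟨u', L', h₁, h₂, h₃, h₄, h₅, hR'⟩ := hR.write h1 hn hq' T.head
    rw [Tape.write_self] at hR'
    exact ⟨⟨q', T.move d⟩, u', L', _, _, 1, by simp [TM0.step, hM], h₁, h₂, h₃, le_rfl,
      by omega, hR'.move h₄ h₅ d, DTM.run_of_δ rfl hδ⟩
  | write a =>
    obtain ⟨u', L', h₁, h₂, h₃, h₄, h₅, hR'⟩ := hR.write h1 hn hq' a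
    refine ⟨⟨q', T.write a⟩, u', L', _, _, 2, by simp [TM0.step, hM], h₁, h₂, h₃, by omega,
      le_rfl, hR', Run.trans (e := 1) (e' := 1) (DTM.run_of_δ rfl hδ) ?_⟩
    set t' := Function.update t h (letterCode a)
    -- A `TM0` write does not move the head, so the simulation steps right and returns. Since `h ≥
    -- 1`, the detour never ends on the left endmarker, and from the right endmarker the return to
    -- the left is the permitted move.
    have hs : 2 ≤ t' (h + 1) ∧ t' (h + 1) < 6 + Fintype.card Γ := by
      rcases lt_or_eq_of_le hn with hlt | rfl
      · have := hR'.symbol_bounds (i := h + 1) (by omega) (by omega); omega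
      · rw [hR'.rend]; omega
    have hret : (compile M S c).δ (6 + 2 * stateIdx S q') (t' (h + 1)) =
        some (5 + 2 * stateIdx S q', t' (h + 1), Dir.left) := by
      have := stateIdx_lt hq'
      rw [compile_δ_core (by omega) (by omega) (by omega) (by omega),
        show 6 + 2 * stateIdx S q' = (2 * stateIdx S q' + 1) + 5 by omega]
      simp only [coreδ]
      rw [if_neg (by omega), if_pos hs.1]
      congr 2; omega
    convert! DTM.run_of_δ_self rfl hret using 2
    simp only [dirShift]; omega

/-- On an endmarker the simulating machine starts to erase the visited cells. -/
theorem Represents.exists_haltsIn_of_end {n u : ℤ} {L : ℕ} {a : TM0.Cfg Γ Λ}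
    {h : ℤ} {t : ℤ → ℕ} (hR : Represents S n u L a h t) (hh : ¬(1 ≤ h ∧ h ≤ n)) :
    (u = 1 ∨ u + L = n + 1) ∧ ∃ j, HaltsIn (compile M S c).absStep j (simCfg S a.q h t) ∧
      L ^ 2 ≤ j ∧ j ≤ L ^ 2 + 3 * L + 3 := by
  have hlp := hR.le_pos
  have hpl := hR.pos_le
  have hle := hR.le
  have hone := hR.one_le
  have hend := hR.end_le
  have hq := stateIdx_lt hR.mem
  have hl : t (u - 1) = 1 ∨ t (u - 1) = 3 ∨ t (u - 1) = 4 := by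
    rcases eq_or_lt_of_le hone with rfl | hlt
    · exact Or.inl hR.lend
    · exact Or.inr (hR.fresh _ (by omega) (by omega) (by omega))
  have hr : 2 ≤ t (u + L) ∧ t (u + L) < 6 := by
    rcases eq_or_lt_of_le hend with heq | hlt
    · rw [heq, hR.rend]; omega
    · have := hR.fresh (u + L) (by omega) (by omega) (by omega); omega
  have hcore : ∀ σ, 1 ≤ σ → σ ≤ 2 → (compile M S c).δ (5 + 2 * stateIdx S a.q) σ =
      simulate M S a.q σ := by
    intro σ h1 h2
    rw [compile_δ_core (by omega) (by omega) (by omega) (by omega),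
      show 5 + 2 * stateIdx S a.q = 2 * stateIdx S a.q + 5 by omega]
    simp [coreδ, stateOf_stateIdx hR.mem]
  obtain ⟨p, hup, hpL, hrun, huL⟩ : ∃ p, u ≤ p ∧ p ≤ u + L ∧
      Run (compile M S c).absStep 1 (simCfg S a.q h t) ⟨1, p, t⟩ ∧ (u = 1 ∨ u + L = n + 1) := by
    by_cases h0 : h = 0
    · subst h0
      -- As `1 ≤ u` and `u - 1 ≤ h`, a head at `0` forces `u = 1`.
      refine ⟨1, by omega, by omega, ?_, Or.inl (by omega)⟩
      have hδ := hcore 1 (by omega) (by omega)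
      exact DTM.run_of_δ_self (d := Dir.right) hR.lend hδ
    · obtain rfl : h = n + 1 := by omega
      refine ⟨n, by omega, by omega, ?_, Or.inr (by omega)⟩
      have hδ := hcore 2 (by omega) (by omega)
      convert! DTM.run_of_δ_self (d := Dir.left) hR.rend hδ using 2
      simp only [dirShift]; omega
  obtain ⟨j, hj, hjL⟩ := exists_haltsIn_erase (M := M) (S := S) (c := c) L hup hpL hR.visited
    hl hr
  refine ⟨huL, j + 1, hrun.haltsIn hj, ?_, ?_⟩
  · zify; rw [hjL]; nlinarith
  · zify; rw [hjL]; omega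

/-- Each simulated step costs at most two steps and lengthens the block by at most one cell. An
endmarker hit on the way therefore triggers the erasing of at most `L + s` cells. -/
theorem Represents.exists_haltsIn_le (hS : TM0.Supports M (S : Set Λ)) (s : ℕ) {n u : ℤ} {L : ℕ}
    {a : TM0.Cfg Γ Λ} {h : ℤ} {t : ℤ → ℕ} (hR : Represents S n u L a h t)
    (hs : HaltsIn (TM0.step M) s a) :
    ∃ j ≤ (L + s) ^ 2 + 3 * (L + s) + 3 + 2 * s,
      HaltsIn (compile M S c).absStep j (simCfg S a.q h t) := by
  induction s generalizing u L a h t with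
  | zero =>
    by_cases hh : 1 ≤ h ∧ h ≤ n
    · rcases hR.step (c := c) hS hh.1 hh.2 with ⟨-, h0⟩ | ⟨a', _, _, _, _, _, ha', -⟩
      · exact ⟨0, by omega, h0⟩
      · rw [HaltsIn, ha'] at hs; cases hs
    · obtain ⟨-, j, hj, -, hjL⟩ := hR.exists_haltsIn_of_end (M := M) (c := c) hh
      exact ⟨j, by simpa using hjL, hj⟩
  | succ s ih =>
    by_cases hh : 1 ≤ h ∧ h ≤ n
    · rcases hR.step (c := c) hS hh.1 hh.2 with
        ⟨-, h0⟩ | ⟨a', u', L', h', t', e, ha', -, -, hL', -, he, hR', hrun⟩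
      · exact ⟨0, by omega, h0⟩
      · obtain ⟨b, hb, hs⟩ := hs
        cases hb.symm.trans ha'
        obtain ⟨j, hj, hj'⟩ := ih hR' hs
        refine ⟨j + e, ?_, hrun.haltsIn hj'⟩
        have h1 : L' + s ≤ L + (s + 1) := by omega
        have h2 := Nat.pow_le_pow_left h1 2
        omega
    · obtain ⟨-, j, hj, -, hjL⟩ := hR.exists_haltsIn_of_end (M := M) (c := c) hh
      refine ⟨j, ?_, hj⟩
      have h2 := Nat.pow_le_pow_left (show L ≤ L + (s + 1) by omega) 2
      omega

/-- As `M` runs forever, halting is possible only after an endmarker has been hit. The block always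
reaches from `u ≤ m + 1` to `u + L ≥ m + 1`. If it touches the left end (`u = 1`) or the right end
(`u + L = n + 1 ≥ 2 * m + 1`), then `L ≥ m`. The induction on `j` works because every simulated step
takes at least one step. -/
theorem Represents.sq_le_of_haltsIn (hS : TM0.Supports M (S : Set Λ)) {m : ℕ} (j : ℕ) {n u : ℤ}
    {L : ℕ} {a : TM0.Cfg Γ Λ} {h : ℤ} {t : ℤ → ℕ} (hR : Represents S n u L a h t)
    (hs : ∀ s, ¬HaltsIn (TM0.step M) s a) (hum : u ≤ m + 1) (hmu : m + 1 ≤ u + L)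
    (hn : 2 * m ≤ n) (hj : HaltsIn (compile M S c).absStep j (simCfg S a.q h t)) :
    m ^ 2 ≤ j := by
  induction j using Nat.strong_induction_on generalizing u L a h t with
  | _ j ih =>
    by_cases hh : 1 ≤ h ∧ h ≤ n
    · rcases hR.step (c := c) hS hh.1 hh.2 with
        ⟨h0, -⟩ | ⟨a', u', L', h', t', e, ha', hu, huL, -, he, -, hR', hrun⟩
      · exact absurd h0 (hs 0)
      · obtain ⟨k, rfl, hk⟩ := (hrun j).1 hj
        have := ih k (by omega) hR' (fun s h => hs (s + 1) ⟨a', ha', h⟩) (by omega) (by omega) hk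
        omega
    · obtain ⟨huL, i, hi, hLi, -⟩ := hR.exists_haltsIn_of_end (M := M) (c := c) hh
      rw [hj.unique hi]
      exact (Nat.pow_le_pow_left (show m ≤ L by omega) 2).trans hLi

end Simulation

/-! ### The initial tape. -/

theorem nth_mk₁_natCast {Γ : Type*} [Inhabited Γ] (l : List Γ) (k : ℕ) :
    (Tape.mk₁ l).nth k = l.getI k := by
  rw [Tape.mk₁, Tape.mk₂, Tape.mk'_nth_nat, ListBlank.nth_mk]

theorem nth_mk₁_of_neg {Γ : Type*} [Inhabited Γ] (l : List Γ) {i : ℤ} (hi : i < 0) :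
    (Tape.mk₁ l).nth i = default := by
  obtain ⟨k, rfl⟩ := Int.eq_negSucc_of_lt_zero hi
  change (ListBlank.mk ([] : List Γ)).nth k = default
  rw [ListBlank.nth_mk, List.getI_nil]

/-- The cells `t` hold a word of length `n` over the letters `3` and `4` between endmarkers. -/
structure InputCells (n : ℤ) (t : ℤ → ℕ) : Prop where
  lend : t 0 = 1
  rend : t (n + 1) = 2
  fresh : ∀ i, 1 ≤ i → i ≤ n → t i = 3 ∨ t i = 4

theorem nth_input_succ (w : List ℕ) {i : ℕ} (hi : i < w.length) :
    (Tape.mk₁ (DTM.lend :: (w ++ [DTM.rend]))).nth (i + 1 : ℕ) = w[i] := by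
  rw [nth_mk₁_natCast, List.getI_cons_succ, List.getI_append _ _ _ hi, List.getI_eq_getElem]

theorem inputCells_nth {w : List ℕ} (hw : ∀ a ∈ w, a = 3 ∨ a = 4) :
    InputCells w.length (Tape.mk₁ (DTM.lend :: (w ++ [DTM.rend]))).nth where
  lend := nth_mk₁_natCast _ 0
  rend := by
    have := nth_mk₁_natCast (DTM.lend :: (w ++ [DTM.rend])) (w.length + 1)
    push_cast at this
    rw [this, List.getI_cons_succ, List.getI_append_right _ _ _ le_rfl]
    simp [DTM.rend]
  fresh := fun i h1 hn => by
    obtain ⟨k, rfl⟩ : ∃ k : ℕ, i = (k + 1 : ℕ) := ⟨(i - 1).toNat, by omega⟩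
    have hk : k < w.length := by omega
    rw [nth_input_succ w hk]
    exact hw _ (List.getElem_mem hk)

/-! ### The start-up phase and the two time estimates. -/

section Start

variable {Γ Λ : Type} [Inhabited Γ] [Inhabited Λ] [Fintype Γ]
variable {M : TM0.Machine Γ Λ} {S : Finset Λ} {c : List ℕ}

theorem run_walk {t : ℤ → ℕ} (b : ℕ) (h0 : t 0 = 1)
    (hb : ∀ i : ℤ, 1 ≤ i → i < b → t i = 3) :
    Run (compile M S c).absStep b ⟨0, 0, t⟩ ⟨0, b, t⟩ := by
  have h : ∀ σ, σ = 1 ∨ σ = 3 → (compile M S c).δ 0 σ = some (0, σ, Dir.right) := fun σ hσ => by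
    rw [compile_δ_core (by omega) (by omega) (by omega) (by omega)]
    simp [coreδ, hσ]
  convert! DTM.run_sweep (M := compile M S c) (p := 0) h (t := t) (h := 0) b ?_ using 2
  · simp [dirShift]
  · intro i hi
    rcases Nat.eq_zero_or_pos i with rfl | hi'
    · left; simpa using h0
    · right
      exact hb _ (by simp only [dirShift]; omega) (by simp only [dirShift]; omega)

theorem exists_run_prefix (i : ℕ) (hi : i ≤ c.length) {h : ℤ} {t : ℤ → ℕ} (hh : i ≤ h)
    (hf : ∀ x, 1 ≤ x → x ≤ h → t x = 3 ∨ t x = 4) :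
    ∃ t' : ℤ → ℕ, Run (compile M S c).absStep i ⟨prefixState S.card i, h, t⟩ ⟨4, h - i, t'⟩ ∧
      (∀ x : ℕ, x < i → t' (h - i + 1 + x) = c.getD x 0) ∧
      ∀ y, y ≤ h - i ∨ h < y → t' y = t y := by
  induction i generalizing h t with
  | zero => exact ⟨t, by simpa [prefixState] using Run.refl _ _, by simp, by simp⟩
  | succ i ih =>
    push_cast at hh
    obtain ⟨t', hrun, hc, ht⟩ := ih (by omega) (h := h - 1)
      (t := Function.update t h (c.getD i 0)) (by omega)
      (fun x hx hx' => by rw [Function.update_of_ne (by omega)]; exact hf x hx (by omega))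
    have hpos : h - 1 - i = h - (i + 1 : ℕ) := by push_cast; ring
    rw [hpos] at hrun hc ht
    refine ⟨t', ?_, fun x hx => ?_, fun y hy => ?_⟩
    · have h1 : Run (compile M S c).absStep 1 _ _ := DTM.run_of_δ (h := h) (t := t) rfl
        (compile_δ_prefix (M := M) (S := S) (show i < c.length by omega)
          (hf h (by omega) le_rfl))
      have h2 := h1.trans hrun
      rwa [add_comm 1 i] at h2
    · rcases Nat.lt_succ_iff_lt_or_eq.1 hx with hx | rfl
      · exact hc x hx
      · rw [ht _ (Or.inr (by push_cast; omega)),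
          show h - (x + 1 : ℕ) + 1 + x = h by push_cast; ring, Function.update_self]
    · rw [ht y (by omega), Function.update_of_ne (by push_cast at hy; omega)]

/-- This covers inputs whose first `4` is too close to the left endmarker: the writing breaks off
within `i` steps. -/
theorem exists_haltsIn_prefix_of_lt (i : ℕ) (hi : i ≤ c.length) {h : ℤ} {t : ℤ → ℕ}
    (h0 : 0 ≤ h) (hh : h < i) (ht : t 0 = 1) (hf : ∀ x, 1 ≤ x → x ≤ h → t x = 3 ∨ t x = 4) :
    ∃ j ≤ i, HaltsIn (compile M S c).absStep j ⟨prefixState S.card i, h, t⟩ := by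
  induction i generalizing h t with
  | zero => simp at hh; omega
  | succ i ih =>
    push_cast at hh
    rcases eq_or_lt_of_le h0 with rfl | hpos
    · exact ⟨0, by omega, DTM.haltsIn_zero_of_δ ht compile_δ_prefix_lend⟩
    · obtain ⟨j, hj, hj'⟩ := ih (by omega) (h := h - 1)
        (t := Function.update t h (c.getD i 0)) (by omega) (by omega)
        (by rw [Function.update_of_ne (by omega), ht])
        (fun x hx hx' => by rw [Function.update_of_ne (by omega)]; exact hf x hx (by omega))
      exact ⟨j + 1, by omega, (DTM.run_of_δ (h := h) (t := t) rfl
        (compile_δ_prefix (M := M) (S := S) (show i < c.length by omega)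
          (hf h (by omega) le_rfl))).haltsIn hj'⟩

/-- From the first symbol `4`, the machine moves to the cell before it. -/
theorem run_zero_four {b : ℤ} {t : ℤ → ℕ} (hb : t b = 4) :
    Run (compile M S c).absStep 1 ⟨0, b, t⟩ ⟨prefixState S.card c.length, b - 1, t⟩ :=
  DTM.run_of_δ_self hb compile_δ_zero_four

/-- The step count is `b` for the walk, `1` for turning at the `4`, `l.length` for writing, and `1`
for stepping back onto the first letter. The initial block is exactly the written word; everything
outside it decodes to the blank. -/
theorem exists_run_start (hS : TM0.Supports M (S : Set Λ)) {l : List Γ} {n : ℤ} {t : ℤ → ℕ}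
    (ht : InputCells n t) {b : ℕ} (hlb : l.length < b) (hbn : b ≤ n) (hb : t b = 4)
    (hlt : ∀ i : ℤ, 1 ≤ i → i < b → t i = 3) :
    ∃ t', Run (compile M S (l.map letterCode)).absStep (b + 1 + l.length + 1) ⟨0, 0, t⟩
        (simCfg S (TM0.init l : TM0.Cfg Γ Λ).q (b - l.length) t') ∧
      Represents S n (b - l.length) l.length (TM0.init l : TM0.Cfg Γ Λ) (b - l.length) t' := by
  have hfr := ht.fresh
  obtain ⟨t', hrun, hc, ht'⟩ := exists_run_prefix (M := M) (S := S) (c := l.map letterCode)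
    l.length (by simp) (h := b - 1) (t := t) (by omega)
    (fun x hx hx' => hfr x hx (by omega))
  have hw := run_walk (M := M) (S := S) (c := l.map letterCode) b ht.lend hlt
  have h4 := run_zero_four (M := M) (S := S) (c := l.map letterCode) hb
  rw [List.length_map] at h4
  have hsym : t' (b - 1 - l.length) = 1 ∨ t' (b - 1 - l.length) = 3 ∨
      t' (b - 1 - l.length) = 4 := by
    rw [ht' _ (Or.inl le_rfl)]
    by_cases h0 : (b : ℤ) - 1 - l.length = 0
    · rw [h0]; exact Or.inl ht.lend
    · exact Or.inr (hfr _ (by omega) (by omega))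
  have hlast : Run (compile M S (l.map letterCode)).absStep 1 ⟨4, b - 1 - l.length, t'⟩
      (simCfg S (TM0.init l : TM0.Cfg Γ Λ).q (b - l.length) t') := by
    have hδ : (compile M S (l.map letterCode)).δ 4 (t' (b - 1 - l.length)) =
        some (5 + 2 * stateIdx S default, t' (b - 1 - l.length), Dir.right) := by
      rw [compile_δ_core (by omega) (by omega) (by omega) (by omega)]
      simp [coreδ, hsym]
    convert! DTM.run_of_δ_self rfl hδ using 2
    simp only [dirShift]; omega
  have hcell : ∀ x : ℕ, ∀ hx : x < l.length, t' (b - l.length + x) = letterCode l[x] := by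
    intro x hx
    have := hc x hx
    rw [List.getD_eq_getElem _ _ (by simpa using hx), List.getElem_map] at this
    rw [← this]; congr 1; ring
  refine ⟨t', ((hw.trans h4).trans hrun).trans hlast,
    { mem := Finset.mem_coe.1 hS.1, one_le := by omega, le := by omega, end_le := by omega,
      le_pos := by omega, pos_le := by omega, lend := ?_, rend := ?_, visited := ?_,
      fresh := ?_, letter := ?_ }⟩
  · rw [ht' _ (by omega), ht.lend]
  · rw [ht' _ (by omega), ht.rend]
  · intro i hi hi'
    obtain ⟨x, rfl⟩ := Int.le.dest hi
    rw [hcell x (by omega)]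
    exact ⟨six_le_letterCode _, letterCode_lt _⟩
  · intro i hi hi' hout
    rw [ht' _ (by omega)]
    exact hfr i hi hi'
  · intro i hi hi'
    change _ = (Tape.mk₁ l).nth _
    by_cases hin : (b : ℤ) - l.length ≤ i
    · obtain ⟨x, rfl⟩ := Int.le.dest hin
      rw [add_sub_cancel_left, nth_mk₁_natCast]
      by_cases hx : x < l.length
      · rw [hcell x hx, letterOf_letterCode, List.getI_eq_getElem _ hx]
      · rw [List.getI_eq_default _ (by omega), ht' _ (by omega)]
        have := hfr _ hi hi'
        exact letterOf_of_lt (by omega)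
    · rw [nth_mk₁_of_neg _ (by omega), ht' _ (by omega)]
      have := hfr _ hi hi'
      exact letterOf_of_lt (by omega)

theorem linearTime_of_haltsIn (hS : TM0.Supports M (S : Set Λ)) {l : List Γ} {s : ℕ}
    (hs : HaltsIn (TM0.step M) s (TM0.init l)) :
    (compile M S (l.map letterCode)).LinearTime := by
  -- Only the walk, of at most `|w| + 1` steps, depends on the input. The constant pays for the rest
  -- of the start-up and for `exists_haltsIn_le` with an initial block of length `l.length`.
  refine ⟨1, l.length + 2 + ((l.length + s) ^ 2 + 3 * (l.length + s) + 3 + 2 * s),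
    fun w hw => ?_⟩
  rw [DTM.haltsWithin_iff]
  have hin : InputCells w.length _ := inputCells_nth fun a ha => by
    simpa [compile] using hw a ha
  set t := (Tape.mk₁ (DTM.lend :: (w ++ [DTM.rend]))).nth with ht
  change ∃ k ≤ _, HaltsIn _ k (⟨0, 0, t⟩ : AbsCfg)
  by_cases hex : ∃ b : ℕ, 1 ≤ b ∧ b ≤ w.length ∧ t b = 4
  · classical
    obtain ⟨h1, hbn, hb⟩ := Nat.find_spec hex
    have hmin : ∀ i : ℤ, 1 ≤ i → i < Nat.find hex → t i = 3 := by
      intro i hi hi'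
      obtain ⟨k, rfl⟩ : ∃ k : ℕ, i = k := ⟨i.toNat, by omega⟩
      have := Nat.find_min hex (m := k) (by omega)
      exact (hin.fresh k hi (by omega)).resolve_right
        fun h => this ⟨by omega, by omega, h⟩
    set b := Nat.find hex
    by_cases hlb : l.length < b
    · obtain ⟨t', hrun, hR⟩ := exists_run_start hS hin hlb (by omega) hb hmin
      obtain ⟨j, hj, hj'⟩ := hR.exists_haltsIn_le (c := l.map letterCode) hS s hs
      exact ⟨_, by omega, hrun.haltsIn hj'⟩
    · obtain ⟨j, hj, hj'⟩ := exists_haltsIn_prefix_of_lt (M := M) (S := S)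
        (c := l.map letterCode) (l.map letterCode).length le_rfl (h := b - 1) (t := t)
        (by omega) (by rw [List.length_map]; omega) hin.lend
        (fun x hx hx' => hin.fresh x hx (by omega))
      rw [List.length_map] at hj
      exact ⟨_, by omega, ((run_walk b hin.lend hmin).trans (run_zero_four hb)).haltsIn hj'⟩
  -- Without a `4` the walk ends on the right endmarker, where state `0` has no transition.
  · have hw3 : ∀ i : ℤ, 1 ≤ i → i < (w.length + 1 : ℕ) → t i = 3 := by
      intro i hi hi'
      obtain ⟨k, rfl⟩ : ∃ k : ℕ, i = k := ⟨i.toNat, by omega⟩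
      exact (hin.fresh k hi (by omega)).resolve_right
        fun h => hex ⟨k, by omega, by omega, h⟩
    have hδ : (compile M S (l.map letterCode)).δ 0 2 = none := by
      rw [compile_δ_core (by omega) (by omega) (by omega) (by omega)]
      simp [coreδ]
    exact ⟨_, by omega, (run_walk (w.length + 1) hin.lend hw3).haltsIn
      (DTM.haltsIn_zero_of_δ (by push_cast; exact hin.rend) hδ)⟩

theorem not_linearTime_of_not_haltsIn (hS : TM0.Supports M (S : Set Λ)) {l : List Γ}
    (hs : ∀ s, ¬HaltsIn (TM0.step M) s (TM0.init l)) :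
    ¬(compile M S (l.map letterCode)).LinearTime := by
  rintro ⟨K, C, hKC⟩
  -- The summand `l.length` makes the word fit to the left of the `4`; the rest gives `m ^ 2 > K *
  -- (2 * m + 1) + C`.
  set m := 3 * K + C + 1 + l.length with hm
  set w := List.replicate m 3 ++ 4 :: List.replicate m 3 with hwdef
  have hwl : w.length = 2 * m + 1 := by simp [hwdef]; omega
  have hw34 : ∀ a ∈ w, a = 3 ∨ a = 4 := by
    intro a ha
    simp only [hwdef, List.mem_append, List.mem_cons, List.mem_replicate] at ha
    omega
  have hin := inputCells_nth hw34
  have hnth := fun i (hi : i < w.length) => nth_input_succ w hi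
  obtain ⟨j, hj, hj'⟩ := (DTM.haltsWithin_iff _ _ _).1
    (hKC w fun a ha => by simpa [compile] using hw34 a ha)
  change HaltsIn _ j (⟨0, 0, (Tape.mk₁ (DTM.lend :: (w ++ [DTM.rend]))).nth⟩ : AbsCfg) at hj'
  set t := (Tape.mk₁ (DTM.lend :: (w ++ [DTM.rend]))).nth with ht
  have hb : t (m + 1 : ℕ) = 4 := by
    rw [hnth m (by omega)]; simp [hwdef]
  have hlt : ∀ i : ℤ, 1 ≤ i → i < (m + 1 : ℕ) → t i = 3 := by
    intro i hi hi'
    obtain ⟨k, rfl⟩ : ∃ k : ℕ, i = (k + 1 : ℕ) := ⟨(i - 1).toNat, by omega⟩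
    have hk : k < m := by omega
    rw [hnth k (by omega)]
    simp only [hwdef]
    rw [List.getElem_append_left (by simpa using hk), List.getElem_replicate]
  obtain ⟨t', hrun, hR⟩ := exists_run_start hS hin (b := m + 1) (l := l) (by omega) (by omega)
    hb hlt
  obtain ⟨k, rfl, hk⟩ := (hrun j).1 hj'
  have hsq := hR.sq_le_of_haltsIn hS (m := m) k hs (by push_cast; omega) (by push_cast; omega)
    (by omega) hk
  rw [hwl] at hj
  have : m * m ≤ K * (2 * m + 1) + C := by rw [← sq]; omega
  have h1 : m * (2 * K + (K + C + 1)) ≤ m * m := Nat.mul_le_mul_left m (by omega)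
  have h2 : K + C + 1 ≤ m * (K + C + 1) := Nat.le_mul_of_pos_left _ (by omega)
  nlinarith

end Start

end OneTape

/-! ### The reduction. -/

/-- It is undecidable whether an end-marked deterministic one-tape Turing machine works in linear
time. -/
theorem mainTheorem5 : ¬ OneTape.DecidableOn OneTape.DTM.EndMarked OneTape.DTM.LinearTime := by
  rintro ⟨f, hf, hfM⟩
  have hφ : Partrec fun n : ℕ => (Denumerable.ofNat Nat.Partrec.Code n).eval 0 :=
    Nat.Partrec.Code.eval_part.comp (Computable.ofNat _) (Computable.const 0)
  obtain ⟨Γ, Λ, _, _, _, M, S, input, hS, hinput, hdom⟩ := OneTape.exists_tm0_of_partrec hφ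
  let D (n : ℕ) := OneTape.compile M S ((input n).map OneTape.letterCode)
  have hD : Computable D := (OneTape.primrec_compile M S).to_comp.comp (hinput _)
  have hlin : ∀ n, (D n).LinearTime ↔ ((Denumerable.ofNat Nat.Partrec.Code n).eval 0).Dom := by
    intro n
    rw [← hdom n, OneTape.eval_dom_iff_haltsIn]
    constructor
    · intro h
      by_contra! hs
      exact OneTape.not_linearTime_of_not_haltsIn hS hs h
    · rintro ⟨s, hs⟩
      exact OneTape.linearTime_of_haltsIn hS hs
  have hend : ∀ n, (D n).EndMarked := fun n => OneTape.compile_endMarked hS fun σ hσ => by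
    obtain ⟨a, -, rfl⟩ := List.mem_map.1 hσ
    exact ⟨OneTape.six_le_letterCode a, OneTape.letterCode_lt a⟩
  -- The decision procedure may diverge on other codes, but every `D n` is end-marked, so its
  -- composition with `D` is the total function `b`.
  choose b hb hbD using fun n => hfM (D n) (hend n)
  refine OneTape.halting_problem_nat (ComputablePred.computable_iff.2 ⟨b, ?_, ?_⟩)
  · exact (hf.comp hD).of_eq fun n => Part.eq_some_iff.2 (hb n)
  · funext n
    rw [eq_iff_iff, ← hlin n, ← hbD n]
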